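/- Let $\mu$ be normalized arc length (Haar probability measure) on the unit circle $\mathbb{T}$, let $\lambda$ be a Borel probability measure on $\mathbb{T}$ with $\lambda\ll\mu$ and $\mu\ll\lambda$, and put $g=d\lambda/d\mu$. Let $1\le p<\infty$ and let $H^p(\mu)$ denote the closure in $L^p(\mu)$ (complex-valued functions) of the polynomials in $z$. Let $W$ be a closed linear subspace of $L^p(\lambda)$ with $zW\subseteq W$. Then $g^{1/p}W=\chi_E L^p(\mu)$ for some Borel set $E\subseteq\mathbb{T}$, or $g^{1/p}W=\varphi H^p(\mu)$ for some unimodular function $\varphi$, that is, a measurable $\varphi:\mathbb{T}\to\mathbb{C}$ with $|\varphi|=1$ $\mu$-almost everywhere. -/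

import Mathlib

open MeasureTheory Polynomial
open scoped ENNReal

noncomputable section

namespace HardyCircle

/-- The Borel σ-algebra of the unit circle. -/
instance instMeasurableSpaceCircle : MeasurableSpace Circle := borel Circle

instance instBorelSpaceCircle : BorelSpace Circle := ⟨rfl⟩

/-- Normalized arc length (Haar probability measure) on the unit circle. -/
def arc : Measure Circle := Measure.haarMeasure ⊤

/-- The set `w S = {w f : f ∈ S}` for a set `S` of elements of `L^p(ν)`, as a set of classes of
functions modulo equality `μ`-almost everywhere. It is used with `μ ≪ ν`, so that the class of
`w f` does not depend on the representative of `f`. -/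
def mulImage {p : ℝ≥0∞} {ν : Measure Circle} (μ : Measure Circle) (w : Circle → ℂ)
    (S : Set (Lp ℂ p ν)) : Set (Circle →ₘ[μ] ℂ) :=
  {h | ∃ f ∈ S, ∀ᵐ z ∂μ, h z = w z * f z}

/-- `z W ⊆ W`: with every `f`, the set `W` contains the function `z ↦ z f(z)`. -/
def ZInvariant {p : ℝ≥0∞} {ν : Measure Circle} (W : Set (Lp ℂ p ν)) : Prop :=
  ∀ f ∈ W, ∃ h ∈ W, ∀ᵐ z ∂ν, h z = (z : ℂ) * f z

/-- The Hardy space `H^p(ν)`: the closure in `L^p(ν)` of the polynomials in `z`. -/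
def hardy (p : ℝ≥0∞) [Fact (1 ≤ p)] (ν : Measure Circle) : Set (Lp ℂ p ν) :=
  closure {f : Lp ℂ p ν | ∃ P : ℂ[X], ∀ᵐ z ∂ν, f z = P.eval (z : ℂ)}

/-- A unimodular function: a measurable function of modulus one almost everywhere. -/
def Unimodular (φ : Circle → ℂ) : Prop :=
  Measurable φ ∧ ∀ᵐ z ∂arc, ‖φ z‖ = 1

/-- The function `g^{1/p}`, where `g = dν/dμ` with `μ` normalized arc length. -/
def densityRoot (p : ℝ≥0∞) (ν : Measure Circle) (z : Circle) : ℂ :=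
  (((ν.rnDeriv arc z).toReal ^ (1 / p.toReal) : ℝ) : ℂ)

end HardyCircle

end

/-!
Multiplication by `g^{1/p}` is an isometry of `L^p(ν)` into `L^p` of arc length, so it is enough to
describe the closed `z`-invariant subspaces `M` for arc length. Such an `M` is determined by its
bounded elements: if `q` is the analytic completion of `√F`, `F` integrable, then the functions
`exp (-q / n)` are contractive multipliers of `M` which make `F` bounded and tend to `1`.
Hence `M` may be replaced by the closure `K` in `L²` of its square-integrable elements. If `zK = K`,
then all Fourier coefficients of `f * conj r` vanish for `f ∈ K` and `r ⊥ K`, and `K = χ_E L²` with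
`E` the support of the projection of `1` to `K`. Otherwise a unit vector `φ` of `K ⊖ zK` satisfies
`∫ zⁿ |φ|² = 0` for all `n ≠ 0`, so it is unimodular, and `K = φ H²` since the Fourier coefficients
of `s * conj φ` vanish for every `s ∈ K ⊖ φ H²`.
-/

noncomputable section

namespace HardyCircle

open Filter Topology ComplexConjugate

section LpSpaces

variable {α : Type*} [MeasurableSpace α] {μ : Measure α} {p : ℝ≥0∞}

theorem tendsto_eLpNorm_sub_of_dominated {E : Type*} [NormedAddCommGroup E] (hp1 : 1 ≤ p)
    (hp : p ≠ ∞) {f : ℕ → α → E} {g : α → E} {G : α → ℝ} (hG : MemLp G p μ) (hg : MemLp g p μ)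
    (hf : ∀ n, AEStronglyMeasurable (f n) μ) (hb : ∀ n, ∀ᵐ x ∂μ, ‖f n x‖ ≤ G x)
    (hlim : ∀ᵐ x ∂μ, Tendsto (fun n => f n x) atTop (𝓝 (g x))) :
    Tendsto (fun n => eLpNorm (f n - g) p μ) atTop (𝓝 0) := by
  have hle (n : ℕ) (s : Set α) :
      eLpNorm (s.indicator (f n)) p μ ≤ eLpNorm (s.indicator G) p μ := by
    refine eLpNorm_mono_ae ?_
    filter_upwards [hb n] with x hx
    rw [norm_indicator_eq_indicator_norm, norm_indicator_eq_indicator_norm]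
    exact Set.indicator_le_indicator (hx.trans (le_abs_self _))
  refine tendsto_Lp_of_tendsto_ae hp1 hp hf hg (fun ε hε => ?_) (fun ε hε => ?_) hlim
  · obtain ⟨δ, hδ, h⟩ := unifIntegrable_const (ι := ℕ) hp1 hp hG hε
    exact ⟨δ, hδ, fun n s hs hμs => (hle n s).trans (h n s hs hμs)⟩
  · obtain ⟨s, hs, h⟩ := unifTight_const (ι := ℕ) hp hG hε
    exact ⟨s, hs, fun n => (hle n sᶜ).trans (h n)⟩

theorem exists_seq_dominated_of_mem_closure {E : Type*} [NormedAddCommGroup E] [Fact (1 ≤ p)]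
    {S : Set (Lp E p μ)} {g : Lp E p μ} (hg : g ∈ closure S) :
    ∃ (f : ℕ → Lp E p μ) (F : α → ℝ), (∀ n, f n ∈ S) ∧ MemLp F p μ ∧
      (∀ n, ∀ᵐ x ∂μ, ‖f n x‖ ≤ F x) ∧ ∀ᵐ x ∂μ, Tendsto (fun n => f n x) atTop (𝓝 (g x)) := by
  choose f hfS hf using fun n : ℕ =>
    EMetric.mem_closure_iff.1 hg ((2⁻¹ : ℝ≥0∞) ^ n) (by simp [ENNReal.pow_pos])
  let d (n : ℕ) : Lp ℝ p μ := (Lp.memLp (f n - g)).norm.toLp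
  have hd : ∑' n, ‖d n‖ₑ ≠ ∞ := by
    refine ne_top_of_le_ne_top (b := ∑' n : ℕ, (2⁻¹ : ℝ≥0∞) ^ n) (by simp)
      (ENNReal.tsum_le_tsum fun n => ?_)
    rw [Lp.enorm_toLp, eLpNorm_norm, ← Lp.enorm_def, ← edist_eq_enorm_sub, edist_comm]
    exact (hf n).le
  have hdiff : ∀ᵐ x ∂μ, ∀ n, d n x = ‖f n x - g x‖ := by
    refine ae_all_iff.2 fun n => ?_
    filter_upwards [(Lp.memLp (f n - g)).norm.coeFn_toLp, Lp.coeFn_sub (f n) g] with x hx hsub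
    rw [hx, hsub, Pi.sub_apply]
  refine ⟨f, fun x => ‖g x‖ + (∑' n, d n : Lp ℝ p μ) x, hfS,
    (Lp.memLp g).norm.add (Lp.memLp _), fun n => ?_, ?_⟩
  · filter_upwards [Lp.hasSum_coeFn_tsum hd, hdiff] with x hsum hx
    simp only [hx] at hsum
    linarith [norm_le_norm_add_norm_sub' (f n x) (g x),
      le_hasSum hsum n fun _ _ => norm_nonneg _]
  · filter_upwards [Lp.hasSum_coeFn_tsum hd, hdiff] with x hsum hx
    simp only [hx] at hsum
    exact tendsto_iff_norm_sub_tendsto_zero.2 hsum.summable.tendsto_atTop_zero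

/-- The function `f` represents an element of the subspace `M`. -/
def HasRep (M : Submodule ℂ (Lp ℂ p μ)) (f : α → ℂ) : Prop :=
  ∃ h ∈ M, (h : α → ℂ) =ᵐ[μ] f

namespace HasRep

variable {M : Submodule ℂ (Lp ℂ p μ)} {f g : α → ℂ}

theorem memLp (hf : HasRep M f) : MemLp f p μ := by
  obtain ⟨h, -, hf⟩ := hf
  exact (memLp_congr_ae hf).1 (Lp.memLp h)

theorem congr (hf : HasRep M f) (hfg : f =ᵐ[μ] g) : HasRep M g := by
  obtain ⟨h, hM, hf⟩ := hf
  exact ⟨h, hM, hf.trans hfg⟩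

theorem add (hf : HasRep M f) (hg : HasRep M g) : HasRep M (f + g) := by
  obtain ⟨h, hM, hh⟩ := hf
  obtain ⟨k, kM, hk⟩ := hg
  exact ⟨h + k, M.add_mem hM kM, (Lp.coeFn_add h k).trans (hh.add hk)⟩

theorem const_mul (c : ℂ) (hf : HasRep M f) : HasRep M (fun x => c * f x) := by
  obtain ⟨h, hM, hh⟩ := hf
  exact ⟨c • h, M.smul_mem c hM, (Lp.coeFn_smul c h).trans (hh.const_smul c)⟩

end HasRep

theorem hasRep_coeFn_iff {M : Submodule ℂ (Lp ℂ p μ)} {f : Lp ℂ p μ} : HasRep M f ↔ f ∈ M := by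
  refine ⟨fun ⟨h, hM, hf⟩ => ?_, fun hf => ⟨f, hf, ae_eq_rfl⟩⟩
  rwa [← Lp.ext hf]

theorem hasRep_iff_toLp_mem {M : Submodule ℂ (Lp ℂ p μ)} {f : α → ℂ} (hf : MemLp f p μ) :
    HasRep M f ↔ hf.toLp f ∈ M := by
  rw [← hasRep_coeFn_iff]
  exact ⟨fun h => h.congr hf.coeFn_toLp.symm, fun h => h.congr hf.coeFn_toLp⟩

theorem HasRep.of_dominated [Fact (1 ≤ p)] (hp : p ≠ ∞) {M : Submodule ℂ (Lp ℂ p μ)}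
    (hM : IsClosed (M : Set (Lp ℂ p μ))) {f : ℕ → α → ℂ} {g : α → ℂ} {G : α → ℝ}
    (hf : ∀ n, HasRep M (f n)) (hG : MemLp G p μ) (hb : ∀ n, ∀ᵐ x ∂μ, ‖f n x‖ ≤ G x)
    (hlim : ∀ᵐ x ∂μ, Tendsto (fun n => f n x) atTop (𝓝 (g x))) : HasRep M g := by
  have hfm (n : ℕ) : AEStronglyMeasurable (f n) μ := (hf n).memLp.aestronglyMeasurable
  have hg : MemLp g p μ := by
    refine hG.mono (aestronglyMeasurable_of_tendsto_ae _ hfm hlim) ?_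
    filter_upwards [hlim, ae_all_iff.2 hb] with x hx hbx
    exact (le_of_tendsto' hx.norm hbx).trans (le_abs_self _)
  have ht := (Lp.tendsto_Lp_iff_tendsto_eLpNorm'' f (fun n => (hf n).memLp) g hg).2
    (tendsto_eLpNorm_sub_of_dominated Fact.out hp hG hg hfm hb hlim)
  exact (hasRep_iff_toLp_mem hg).2 (hM.mem_of_tendsto ht
    (Eventually.of_forall fun n => (hasRep_iff_toLp_mem _).1 (hf n)))

theorem HasRep.of_mul_tendsto_one [Fact (1 ≤ p)] (hp : p ≠ ∞) {M : Submodule ℂ (Lp ℂ p μ)}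
    (hM : IsClosed (M : Set (Lp ℂ p μ))) {k : ℕ → α → ℂ} {g : α → ℂ} (hg : MemLp g p μ)
    (hkg : ∀ n, HasRep M (fun x => k n x * g x)) (hk : ∀ n, ∀ᵐ x ∂μ, ‖k n x‖ ≤ 1)
    (hlim : ∀ᵐ x ∂μ, Tendsto (fun n => k n x) atTop (𝓝 1)) : HasRep M g := by
  refine HasRep.of_dominated hp hM hkg hg.norm (fun n => ?_) ?_
  · filter_upwards [hk n] with x hx
    rw [norm_mul]
    exact mul_le_of_le_one_left (norm_nonneg _) hx
  · filter_upwards [hlim] with x hx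
    simpa only [one_mul] using hx.mul_const (g x)

end LpSpaces

section WeightedMultiplication

variable {α : Type*} [MeasurableSpace α] {μ ν : Measure α} {p : ℝ≥0∞} [Fact (1 ≤ p)] {w : α → ℂ}
  (hp : p ≠ ∞) (hw : Measurable w) (hμ : ν.withDensity (fun x => ‖w x‖ₑ ^ p.toReal) = μ)
include hp hw hμ

theorem mul_ae_eq_mul_of_withDensity {f g : α → ℂ} (h : f =ᵐ[μ] g) :
    (fun x => w x * f x) =ᵐ[ν] fun x => w x * g x := by
  have hpos : 0 < p.toReal := ENNReal.toReal_pos (zero_lt_one.trans_le Fact.out).ne' hp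
  rw [← hμ, EventuallyEq, ae_withDensity_iff (hw.enorm.pow_const _)] at h
  filter_upwards [h] with x hx
  rcases eq_or_ne (w x) 0 with h0 | h0
  · simp [h0]
  · rw [hx (by simp [hpos, h0])]

theorem eLpNorm_mul_eq_of_withDensity {f : α → ℂ} (hf : AEStronglyMeasurable f μ) :
    eLpNorm (fun x => w x * f x) p ν = eLpNorm f p μ := by
  subst hμ
  have hp0 : p ≠ 0 := (zero_lt_one.trans_le Fact.out).ne'
  rw [eLpNorm_eq_lintegral_rpow_enorm_toReal hp0 hp, eLpNorm_eq_lintegral_rpow_enorm_toReal hp0 hp,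
    lintegral_withDensity_eq_lintegral_mul₀' (hw.enorm.pow_const _).aemeasurable
      (hf.enorm.pow_const _)]
  simp only [enorm_mul, ENNReal.mul_rpow_of_nonneg _ _ ENNReal.toReal_nonneg, Pi.mul_apply]

theorem memLp_mul_of_withDensity {f : α → ℂ} (hf : MemLp f p μ) :
    MemLp (fun x => w x * f x) p ν := by
  obtain ⟨f', hf', hff'⟩ := hf.aestronglyMeasurable
  refine ⟨⟨fun x => w x * f' x, hw.stronglyMeasurable.mul hf',
    mul_ae_eq_mul_of_withDensity hp hw hμ hff'⟩, ?_⟩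
  rw [eLpNorm_mul_eq_of_withDensity hp hw hμ hf.aestronglyMeasurable]
  exact hf.eLpNorm_lt_top

/-- Multiplication by a weight `w`, as an isometric embedding of `L^p(|w|^p ν)` into `L^p(ν)`. The
domain is given as `L^p(μ)` for a measure `μ` equal to `|w|^p ν`. -/
def weightedMul : Lp ℂ p μ →ₗᵢ[ℂ] Lp ℂ p ν where
  toFun f := (memLp_mul_of_withDensity hp hw hμ (Lp.memLp f)).toLp
  map_add' f g := by
    rw [← MemLp.toLp_add]
    refine MemLp.toLp_congr _ _
      ((mul_ae_eq_mul_of_withDensity hp hw hμ (Lp.coeFn_add f g)).trans ?_)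
    exact Eventually.of_forall fun x => mul_add _ _ _
  map_smul' c f := by
    rw [RingHom.id_apply, ← MemLp.toLp_const_smul]
    refine MemLp.toLp_congr _ _
      ((mul_ae_eq_mul_of_withDensity hp hw hμ (Lp.coeFn_smul c f)).trans ?_)
    exact Eventually.of_forall fun x => mul_left_comm _ _ _
  norm_map' f := by
    change ‖(memLp_mul_of_withDensity hp hw hμ (Lp.memLp f)).toLp‖ = _
    rw [Lp.norm_toLp, eLpNorm_mul_eq_of_withDensity hp hw hμ (Lp.aestronglyMeasurable f),
      Lp.norm_def]

theorem coeFn_weightedMul (f : Lp ℂ p μ) :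
    weightedMul hp hw hμ f =ᵐ[ν] fun x => w x * f x :=
  (memLp_mul_of_withDensity hp hw hμ (Lp.memLp f)).coeFn_toLp

theorem hasRep_map_weightedMul_iff {W : Submodule ℂ (Lp ℂ p μ)} {h : α → ℂ} :
    HasRep (W.map (weightedMul hp hw hμ).toLinearMap) h ↔
      ∃ f ∈ W, h =ᵐ[ν] fun x => w x * f x := by
  constructor
  · rintro ⟨_, ⟨f, hf, rfl⟩, hfh⟩
    exact ⟨f, hf, hfh.symm.trans (coeFn_weightedMul hp hw hμ f)⟩
  · rintro ⟨f, hf, hfh⟩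
    exact ⟨_, ⟨f, hf, rfl⟩, (coeFn_weightedMul hp hw hμ f).trans hfh.symm⟩

theorem isClosed_map_weightedMul {W : Submodule ℂ (Lp ℂ p μ)}
    (hW : IsClosed (W : Set (Lp ℂ p μ))) :
    IsClosed (W.map (weightedMul hp hw hμ).toLinearMap : Set (Lp ℂ p ν)) :=
  (weightedMul hp hw hμ).isometry.isClosedEmbedding.isClosedMap _ hW

end WeightedMultiplication

section Fourier

theorem ae_eq_zero_of_forall_integral_boundedContinuous_smul_eq_zero {X E : Type*}
    [TopologicalSpace X] [MeasurableSpace X] [BorelSpace X] [HasOuterApproxClosed X]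
    [NormedAddCommGroup E] [NormedSpace ℝ E] [CompleteSpace E] {μ : Measure X} {f : X → E}
    (hf : Integrable f μ)
    (h : ∀ g : BoundedContinuousFunction X NNReal, ∫ x, (g x : ℝ) • f x ∂μ = 0) :
    f =ᵐ[μ] 0 := by
  refine ae_eq_zero_of_forall_setIntegral_isClosed_eq_zero hf fun s hs => ?_
  rw [← integral_indicator hs.measurableSet]
  refine tendsto_nhds_unique (tendsto_integral_of_dominated_convergence (fun x => ‖f x‖)
    (F := fun n x => (hs.apprSeq n x : ℝ) • f x) (fun n => ?_) hf.norm
    (fun n => Eventually.of_forall fun x => ?_) (Eventually.of_forall fun x => ?_)) ?_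
  · exact (by fun_prop : Continuous fun x => (hs.apprSeq n x : ℝ)).aestronglyMeasurable.smul
      hf.aestronglyMeasurable
  · rw [norm_smul, Real.norm_of_nonneg NNReal.zero_le_coe]
    exact mul_le_of_le_one_left (norm_nonneg _)
      (HasOuterApproxClosed.apprSeq_apply_le_one hs n x)
  · have hlim := tendsto_pi_nhds.1 (HasOuterApproxClosed.tendsto_apprSeq hs) x
    convert (NNReal.tendsto_coe.2 hlim).smul_const (f x) using 2
    by_cases hx : x ∈ s <;> simp [hx]
  · simp only [h, tendsto_const_nhds]

instance instIsProbabilityMeasureArc : IsProbabilityMeasure arc :=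
  ⟨by simpa [arc] using Measure.haarMeasure_self (G := Circle) (K₀ := ⊤)⟩

instance instIsMulLeftInvariantArc : arc.IsMulLeftInvariant := by
  unfold arc; infer_instance

/-- The character `z ↦ z ^ n`, with an integer exponent, as a continuous function. -/
def monomialMap (n : ℤ) : C(Circle, ℂ) where
  toFun z := (z : ℂ) ^ n
  continuous_toFun := continuous_subtype_val.zpow₀ n fun z => Or.inl (Circle.coe_ne_zero z)

theorem monomialMap_apply (n : ℤ) (z : Circle) : monomialMap n z = (z : ℂ) ^ n := rfl

theorem span_monomialMap_closure_eq_top :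
    (Submodule.span ℂ (Set.range monomialMap)).topologicalClosure = ⊤ := by
  have : Fact (0 < 2 * Real.pi) := ⟨Real.two_pi_pos⟩
  let e : AddCircle (2 * Real.pi) ≃ₜ Circle := AddCircle.homeomorphCircle Real.two_pi_pos.ne'
  let L := ContinuousMap.compRightAlgHom ℂ ℂ (e.symm : C(Circle, AddCircle (2 * Real.pi)))
  have hL (n : ℤ) : L (fourier n) = monomialMap n := by
    ext z
    obtain ⟨x, rfl⟩ := e.surjective z
    calc L (fourier n) (e x) = fourier n x := by simp [L]
      _ = monomialMap n (e x) := by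
        simp [e, monomialMap_apply, fourier_apply, AddCircle.homeomorphCircle_apply,
          AddCircle.toCircle_zsmul]
  refine eq_top_iff.2 fun g _ => ?_
  have hg : g.comp (e : C(AddCircle (2 * Real.pi), Circle)) ∈
      (Submodule.span ℂ (Set.range (fourier (T := 2 * Real.pi)))).topologicalClosure := by
    rw [span_fourier_closure_eq_top]; trivial
  have hgL : L (g.comp (e : C(AddCircle (2 * Real.pi), Circle))) = g := by
    ext z; simp [L]
  rw [← hgL]
  refine map_mem_closure (ContinuousMap.compRightAlgHom_continuous ..) hg fun f hf => ?_
  refine (Submodule.map_span_le L.toLinearMap _ _).2 ?_ (Submodule.mem_map_of_mem hf)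
  rintro _ ⟨n, rfl⟩
  exact Submodule.subset_span ⟨n, (hL n).symm⟩

theorem integral_mul_continuousMap_eq_zero {f : Circle → ℂ} (hf : Integrable f arc)
    (h : ∀ n : ℤ, ∫ z : Circle, f z * (z : ℂ) ^ n ∂arc = 0) (g : C(Circle, ℂ)) :
    ∫ z, f z * g z ∂arc = 0 := by
  let Λ : C(Circle, ℂ) →L[ℂ] ℂ := ((ContinuousLinearMap.mul ℂ ℂ).lpPairing arc 1 ∞
    (hf.toL1 f)).comp (ContinuousMap.toLp ∞ arc ℂ)
  have hΛ (g : C(Circle, ℂ)) : Λ g = ∫ z, f z * g z ∂arc := by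
    refine (ContinuousLinearMap.lpPairing_eq_integral ..).trans (integral_congr_ae ?_)
    filter_upwards [hf.coeFn_toL1, ContinuousMap.coeFn_toLp (p := ∞) (𝕜 := ℂ) arc g]
      with z hfz hgz
    exact congr_arg₂ (· * ·) hfz hgz
  have hker : (⊤ : Submodule ℂ C(Circle, ℂ)) ≤ LinearMap.ker Λ.toLinearMap := by
    rw [← span_monomialMap_closure_eq_top]
    refine Submodule.topologicalClosure_minimal _ (Submodule.span_le.2 ?_) Λ.isClosed_ker
    rintro _ ⟨n, rfl⟩
    exact (hΛ _).trans (h n)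
  exact (hΛ g).symm.trans (hker trivial)

theorem ae_eq_zero_of_forall_integral_mul_zpow_eq_zero {f : Circle → ℂ} (hf : Integrable f arc)
    (h : ∀ n : ℤ, ∫ z : Circle, f z * (z : ℂ) ^ n ∂arc = 0) : f =ᵐ[arc] 0 := by
  refine ae_eq_zero_of_forall_integral_boundedContinuous_smul_eq_zero hf fun g => ?_
  simp only [Complex.real_smul, mul_comm _ (f _)]
  exact integral_mul_continuousMap_eq_zero hf h ⟨fun z => ((g z : ℝ) : ℂ), by fun_prop⟩

theorem integral_zpow_arc {n : ℤ} (hn : n ≠ 0) : ∫ z : Circle, (z : ℂ) ^ n ∂arc = 0 := by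
  have hw : ((Circle.exp (Real.pi / n) : Circle) : ℂ) ^ n = -1 := by
    have hn' : (n : ℂ) ≠ 0 := by exact_mod_cast hn
    rw [Circle.coe_exp, ← Complex.exp_int_mul, ← Complex.exp_pi_mul_I]
    congr 1
    push_cast
    field_simp
  have hrot := integral_mul_left_eq_self (μ := arc) (fun z : Circle => (z : ℂ) ^ n)
    (Circle.exp (Real.pi / n))
  simp only [Circle.coe_mul, mul_zpow, hw, integral_const_mul] at hrot
  linear_combination (-1 / 2 : ℂ) * hrot

theorem conj_coe_zpow (n : ℤ) (z : Circle) : conj ((z : ℂ) ^ n) = (z : ℂ) ^ (-n) := by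
  rw [map_zpow₀, ← Circle.coe_inv_eq_conj, Circle.coe_inv, inv_zpow, zpow_neg]

end Fourier

section AnalyticCompletion

theorem exists_polynomial_add_conj_of_mem_span {g : C(Circle, ℂ)}
    (hg : g ∈ Submodule.span ℂ (Set.range monomialMap)) :
    ∃ P Q : ℂ[X], ∀ z : Circle, g z = P.eval (z : ℂ) + conj (Q.eval (z : ℂ)) := by
  induction hg using Submodule.span_induction with
  | mem x hx =>
    obtain ⟨n, rfl⟩ := hx
    rcases n.eq_nat_or_neg with ⟨m, rfl | rfl⟩
    · exact ⟨X ^ m, 0, fun z => by simp [monomialMap_apply]⟩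
    · exact ⟨0, X ^ m, fun z => by rw [monomialMap_apply, ← conj_coe_zpow]; simp⟩
  | zero => exact ⟨0, 0, by simp⟩
  | add x y _ _ hx hy =>
    obtain ⟨P, Q, hPQ⟩ := hx
    obtain ⟨P', Q', hPQ'⟩ := hy
    refine ⟨P + P', Q + Q', fun z => ?_⟩
    simp only [ContinuousMap.add_apply, hPQ, hPQ', eval_add, map_add]
    ring
  | smul a x _ hx =>
    obtain ⟨P, Q, hPQ⟩ := hx
    exact ⟨C a * P, C (conj a) * Q, fun z => by simp [hPQ, mul_add]⟩

theorem exists_polynomial_abs_re_sub_lt (g : C(Circle, ℝ)) {ε : ℝ} (hε : 0 < ε) :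
    ∃ P : ℂ[X], (P.eval 0).im = 0 ∧ ∀ z : Circle, |(P.eval (z : ℂ)).re - g z| < ε := by
  let G : C(Circle, ℂ) := ⟨fun z => (g z : ℂ), by fun_prop⟩
  have hG : G ∈ (Submodule.span ℂ (Set.range monomialMap)).topologicalClosure := by
    rw [span_monomialMap_closure_eq_top]; trivial
  obtain ⟨T, hT, hdist⟩ := Metric.mem_closure_iff.1 hG ε hε
  obtain ⟨P, Q, hPQ⟩ := exists_polynomial_add_conj_of_mem_span hT
  refine ⟨P + Q - C (((P + Q).eval 0).im * Complex.I), by simp, fun z => ?_⟩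
  have hTz : ‖T z - G z‖ < ε := by
    rw [← dist_eq_norm, dist_comm]
    exact (ContinuousMap.dist_apply_le_dist z).trans_lt hdist
  refine lt_of_eq_of_lt ?_ ((Complex.abs_re_le_norm _).trans_lt hTz)
  simp [hPQ, G]

theorem memLp_arc_of_continuous {E : Type*} [NormedAddCommGroup E] {f : Circle → E}
    (hf : Continuous f) (p : ℝ≥0∞) : MemLp f p arc :=
  hf.memLp_of_hasCompactSupport (HasCompactSupport.of_compactSpace f)

theorem integrable_arc_of_continuous {E : Type*} [NormedAddCommGroup E] {f : Circle → E}
    (hf : Continuous f) : Integrable f arc :=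
  hf.integrable_of_hasCompactSupport (HasCompactSupport.of_compactSpace f)

theorem integral_eval_arc (P : ℂ[X]) : ∫ z : Circle, P.eval (z : ℂ) ∂arc = P.eval 0 := by
  induction P using Polynomial.induction_on' with
  | add P Q hP hQ =>
    simp only [eval_add]
    rw [integral_add, hP, hQ] <;> exact integrable_arc_of_continuous (by fun_prop)
  | monomial n a =>
    simp only [eval_monomial, integral_const_mul]
    rcases eq_or_ne n 0 with rfl | hn
    · simp
    · have hzero := integral_zpow_arc (n := n) (by exact_mod_cast hn)
      simp only [zpow_natCast] at hzero
      simp [hzero, hn]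

-- Since `|w|² = 2 (Re w)² - Re w²`, the mean value property for `P²` gives the bound.
theorem integral_norm_sq_eval_le (P : ℂ[X]) (hP : (P.eval 0).im = 0) :
    ∫ z : Circle, ‖P.eval (z : ℂ)‖ ^ 2 ∂arc ≤
      2 * ∫ z : Circle, (P.eval (z : ℂ)).re ^ 2 ∂arc := by
  have hmean : ∫ z : Circle, ((P ^ 2).eval (z : ℂ)).re ∂arc = (P.eval 0).re ^ 2 := by
    have hcont : Continuous fun z : Circle => (P ^ 2).eval (z : ℂ) := by fun_prop
    have hre := integral_re (𝕜 := ℂ) (integrable_arc_of_continuous hcont)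
    simp only [RCLike.re_to_complex] at hre
    rw [hre, integral_eval_arc, eval_pow, sq, Complex.mul_re, hP]
    ring
  calc ∫ z : Circle, ‖P.eval (z : ℂ)‖ ^ 2 ∂arc
      = ∫ z : Circle, (2 * (P.eval (z : ℂ)).re ^ 2 - ((P ^ 2).eval (z : ℂ)).re) ∂arc := by
        congr 1 with z
        rw [eval_pow, sq (P.eval _), Complex.mul_re, Complex.sq_norm, Complex.normSq_apply]
        ring
    _ = 2 * (∫ z : Circle, (P.eval (z : ℂ)).re ^ 2 ∂arc) - (P.eval 0).re ^ 2 := by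
        rw [integral_sub (integrable_arc_of_continuous (by fun_prop))
          (integrable_arc_of_continuous (by fun_prop)), integral_const_mul, hmean]
    _ ≤ _ := by linarith [sq_nonneg (P.eval 0).re]

theorem eLpNorm_eval_le (P : ℂ[X]) (hP : (P.eval 0).im = 0) :
    eLpNorm (fun z : Circle => P.eval (z : ℂ)) 2 arc ≤
      2 * eLpNorm (fun z : Circle => (P.eval (z : ℂ)).re) 2 arc := by
  have hre : Continuous fun z : Circle => (P.eval (z : ℂ)).re := by fun_prop
  calc eLpNorm (fun z : Circle => P.eval (z : ℂ)) 2 arc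
      ≤ eLpNorm ((2 : ℝ) • fun z : Circle => (P.eval (z : ℂ)).re) 2 arc := by
        rw [(memLp_arc_of_continuous (by fun_prop) 2).eLpNorm_eq_integral_rpow_norm (by simp)
            (by simp), (memLp_arc_of_continuous (hre.const_smul 2) 2).eLpNorm_eq_integral_rpow_norm
            (by simp) (by simp)]
        refine ENNReal.ofReal_le_ofReal (Real.rpow_le_rpow (by positivity) ?_ (by simp))
        simp only [ENNReal.toReal_ofNat, Real.rpow_two, norm_smul, mul_pow, Real.norm_eq_abs,
          sq_abs, Pi.smul_apply, integral_const_mul]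
        have hnonneg : 0 ≤ ∫ z : Circle, (P.eval (z : ℂ)).re ^ 2 ∂arc := by positivity
        linarith [integral_norm_sq_eval_le P hP]
    _ = _ := by rw [eLpNorm_const_smul, Real.enorm_of_nonneg zero_le_two, ENNReal.ofReal_ofNat]

theorem exists_continuous_nonneg_eLpNorm_sub_le {u : Circle → ℝ} (hu : MemLp u 2 arc)
    (hu0 : ∀ z, 0 ≤ u z) {ε : ℝ≥0∞} (hε : ε ≠ 0) :
    ∃ g : C(Circle, ℝ), (∀ z, 0 ≤ g z) ∧ eLpNorm (fun z => g z - u z) 2 arc ≤ ε := by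
  obtain ⟨b, hb, -⟩ := hu.exists_boundedContinuous_eLpNorm_sub_le (by simp) hε
  refine ⟨⟨fun z => max (b z) 0, by fun_prop⟩, fun z => le_max_right _ _,
    (eLpNorm_mono fun z => ?_).trans hb⟩
  have hmax := abs_max_sub_max_le_abs (b z) (u z) 0
  rwa [max_eq_left (hu0 z), abs_sub_comm (b z)] at hmax

theorem exists_polynomial_re_nonneg_eLpNorm_sub_le {u : Circle → ℝ} (hu : MemLp u 2 arc)
    (hu0 : ∀ z, 0 ≤ u z) {ε : ℝ} (hε : 0 < ε) :
    ∃ P : ℂ[X], (P.eval 0).im = 0 ∧ (∀ z : Circle, 0 ≤ (P.eval (z : ℂ)).re) ∧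
      eLpNorm (fun z : Circle => (P.eval (z : ℂ)).re - u z) 2 arc ≤ ENNReal.ofReal ε := by
  obtain ⟨g, hg0, hg⟩ := exists_continuous_nonneg_eLpNorm_sub_le hu hu0
    (ε := ENNReal.ofReal (ε / 2)) (by simpa using hε)
  obtain ⟨P, hP, hPg⟩ := exists_polynomial_abs_re_sub_lt (g + ContinuousMap.const _ (ε / 4))
    (ε := ε / 4) (by linarith)
  have hPg' (z : Circle) : 0 < (P.eval (z : ℂ)).re - g z ∧ (P.eval (z : ℂ)).re - g z < ε / 2 := by
    have hz := abs_lt.1 (hPg z)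
    simp only [ContinuousMap.add_apply, ContinuousMap.const_apply] at hz
    constructor <;> linarith
  refine ⟨P, hP, fun z => by linarith [hPg' z, hg0 z], ?_⟩
  calc eLpNorm (fun z : Circle => (P.eval (z : ℂ)).re - u z) 2 arc
      = eLpNorm ((fun z : Circle => (P.eval (z : ℂ)).re - g z) + fun z => g z - u z) 2 arc := by
        congr 1; ext z; simp
    _ ≤ eLpNorm (fun z : Circle => (P.eval (z : ℂ)).re - g z) 2 arc +
          eLpNorm (fun z => g z - u z) 2 arc :=
        eLpNorm_add_le (by fun_prop : Continuous _).aestronglyMeasurable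
          (g.continuous.aestronglyMeasurable.sub hu.aestronglyMeasurable) (by norm_num)
    _ ≤ ENNReal.ofReal (ε / 2) + ENNReal.ofReal (ε / 2) := by
        refine add_le_add ((eLpNorm_le_of_ae_bound (C := ε / 2)
          (Eventually.of_forall fun z => ?_)).trans (by simp)) hg
        rw [Real.norm_eq_abs, abs_of_pos (hPg' z).1]
        exact (hPg' z).2.le
    _ = ENNReal.ofReal ε := by
        rw [← ENNReal.ofReal_add (by linarith) (by linarith), add_halves]

theorem eLpNorm_eval_sub_eval_le {P Q : ℂ[X]} (hP : (P.eval 0).im = 0) (hQ : (Q.eval 0).im = 0)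
    {u : Circle → ℝ} (hu : AEStronglyMeasurable u arc) :
    eLpNorm ((fun z : Circle => P.eval (z : ℂ)) - fun z : Circle => Q.eval (z : ℂ)) 2 arc ≤
      2 * (eLpNorm (fun z : Circle => (P.eval (z : ℂ)).re - u z) 2 arc +
        eLpNorm (fun z : Circle => (Q.eval (z : ℂ)).re - u z) 2 arc) := by
  have hm (R : ℂ[X]) : AEStronglyMeasurable (fun z : Circle => (R.eval (z : ℂ)).re - u z) arc :=
    (by fun_prop : Continuous _).aestronglyMeasurable.sub hu
  calc eLpNorm ((fun z : Circle => P.eval (z : ℂ)) - fun z : Circle => Q.eval (z : ℂ)) 2 arc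
      = eLpNorm (fun z : Circle => (P - Q).eval (z : ℂ)) 2 arc := by
        congr 1; ext z; simp
    _ ≤ 2 * eLpNorm (fun z : Circle => ((P - Q).eval (z : ℂ)).re) 2 arc :=
        eLpNorm_eval_le _ (by simp [hP, hQ])
    _ = 2 * eLpNorm ((fun z : Circle => (P.eval (z : ℂ)).re - u z) -
          fun z : Circle => (Q.eval (z : ℂ)).re - u z) 2 arc := by
        congr 2; ext z; simp
    _ ≤ _ := by
        gcongr
        exact eLpNorm_sub_le (hm P) (hm Q) (by norm_num)

theorem exists_analytic_completion {u : Circle → ℝ} (hu : MemLp u 2 arc) (hu0 : ∀ z, 0 ≤ u z) :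
    ∃ (q : Circle → ℂ) (Q : ℕ → ℂ[X]), (∀ n (z : Circle), 0 ≤ ((Q n).eval (z : ℂ)).re) ∧
      (∀ᵐ z ∂arc, (q z).re = u z) ∧
      ∀ᵐ z : Circle ∂arc, Tendsto (fun n => (Q n).eval (z : ℂ)) atTop (𝓝 (q z)) := by
  choose Q hQ0 hQpos hQ using fun n : ℕ =>
    exists_polynomial_re_nonneg_eLpNorm_sub_le hu hu0 (ε := 2⁻¹ ^ n) (by positivity)
  simp only [ENNReal.ofReal_pow (by norm_num : (0 : ℝ) ≤ 2⁻¹),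
    ENNReal.ofReal_inv_of_pos two_pos, ENNReal.ofReal_ofNat] at hQ
  have hcauchy (N n m : ℕ) (hn : N ≤ n) (hm : N ≤ m) :
      eLpNorm ((fun z : Circle => (Q n).eval (z : ℂ)) - fun z : Circle => (Q m).eval (z : ℂ)) 2 arc
        < 5 * 2⁻¹ ^ N := by
    have hQN {k : ℕ} (hk : N ≤ k) := (hQ k).trans (pow_le_pow_right_of_le_one' (by norm_num) hk)
    calc _ ≤ 2 * (2⁻¹ ^ N + 2⁻¹ ^ N) :=
          (eLpNorm_eval_sub_eval_le (hQ0 n) (hQ0 m) hu.aestronglyMeasurable).trans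
            (mul_le_mul_right (add_le_add (hQN hn) (hQN hm)) 2)
      _ = 4 * 2⁻¹ ^ N := by ring
      _ < 5 * 2⁻¹ ^ N := by
          refine ENNReal.mul_lt_mul_left ?_ ?_ (by norm_num) <;> simp
  have hlim := Lp.ae_tendsto_of_cauchy_eLpNorm
    (fun n => (by fun_prop : Continuous _).aestronglyMeasurable) one_le_two
    (by simp [ENNReal.tsum_mul_left, ENNReal.mul_eq_top]) hcauchy
  have hre := summable_norm_of_tsum_eLpNorm_ne_top one_le_two
    (fun n => (by fun_prop : Continuous _).aestronglyMeasurable.sub hu.aestronglyMeasurable)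
    (ne_top_of_le_ne_top (by simp) (ENNReal.tsum_le_tsum hQ))
  obtain ⟨q, hq⟩ := hlim.choice
  refine ⟨q, Q, hQpos, ?_, hq⟩
  filter_upwards [hq, hre] with z hz hrez
  exact tendsto_nhds_unique ((Complex.continuous_re.tendsto _).comp hz)
    (tendsto_iff_norm_sub_tendsto_zero.2 hrez.tendsto_atTop_zero)

end AnalyticCompletion

section Multipliers

namespace HasRep

variable {p : ℝ≥0∞} {ν : Measure Circle} {M : Submodule ℂ (Lp ℂ p ν)} {f : Circle → ℂ}

theorem coe_mul (hz : ZInvariant (M : Set (Lp ℂ p ν))) (hf : HasRep M f) :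
    HasRep M (fun z => (z : ℂ) * f z) := by
  obtain ⟨h, hM, hh⟩ := hf
  obtain ⟨k, kM, hk⟩ := hz h hM
  refine ⟨k, kM, ?_⟩
  filter_upwards [hh, hk] with z hhz hkz
  rw [hkz, hhz]

theorem coe_pow_mul (hz : ZInvariant (M : Set (Lp ℂ p ν))) (hf : HasRep M f) (n : ℕ) :
    HasRep M (fun z => (z : ℂ) ^ n * f z) := by
  induction n with
  | zero => simpa using hf
  | succ n ih => simpa only [pow_succ', mul_assoc] using ih.coe_mul hz

theorem eval_mul (hz : ZInvariant (M : Set (Lp ℂ p ν))) (hf : HasRep M f) (P : ℂ[X]) :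
    HasRep M (fun z => P.eval (z : ℂ) * f z) := by
  induction P using Polynomial.induction_on' with
  | add P Q hP hQ =>
    refine (hP.add hQ).congr (Eventually.of_forall fun z => ?_)
    simp [add_mul]
  | monomial n a =>
    simpa only [eval_monomial, mul_assoc] using (hf.coe_pow_mul hz n).const_mul a

end HasRep

/-- Multiplication by `k` maps the subspace `M` into itself. -/
def IsMultiplier {p : ℝ≥0∞} {ν : Measure Circle} (M : Submodule ℂ (Lp ℂ p ν))
    (k : Circle → ℂ) : Prop :=
  ∀ f, HasRep M f → HasRep M (fun z => k z * f z)

variable {p : ℝ≥0∞} [Fact (1 ≤ p)] {ν : Measure Circle} {M : Submodule ℂ (Lp ℂ p ν)}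

theorem IsMultiplier.of_bounded_tendsto (hp : p ≠ ∞) (hM : IsClosed (M : Set (Lp ℂ p ν)))
    {k : ℕ → Circle → ℂ} {k' : Circle → ℂ} {C : ℝ} (hk : ∀ n, IsMultiplier M (k n))
    (hb : ∀ n, ∀ᵐ z ∂ν, ‖k n z‖ ≤ C)
    (hlim : ∀ᵐ z ∂ν, Tendsto (fun n => k n z) atTop (𝓝 (k' z))) : IsMultiplier M k' := by
  intro f hf
  refine HasRep.of_dominated hp hM (fun n => hk n f hf) (hf.memLp.norm.const_mul C) (fun n => ?_) ?_
  · filter_upwards [hb n] with z hz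
    rw [norm_mul]
    gcongr
  · filter_upwards [hlim] with z hz using hz.mul_const _

theorem norm_one_add_div_pow_le_exp (w : ℂ) (n : ℕ) : ‖(1 + w / n) ^ n‖ ≤ Real.exp ‖w‖ := by
  rcases Nat.eq_zero_or_pos n with rfl | hn
  · simp
  calc ‖(1 + w / n) ^ n‖ ≤ (‖w‖ / n + 1) ^ n := by
        rw [norm_pow]
        gcongr
        refine (norm_add_le _ _).trans_eq ?_
        rw [norm_one, norm_div, Complex.norm_natCast, add_comm]
    _ ≤ Real.exp (‖w‖ / n) ^ n := by
        gcongr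
        exact Real.add_one_le_exp _
    _ = Real.exp ‖w‖ := by
        rw [← Real.exp_nat_mul]
        congr 1
        field_simp

theorem isMultiplier_exp_neg_eval (hp : p ≠ ∞) (hM : IsClosed (M : Set (Lp ℂ p ν)))
    (hz : ZInvariant (M : Set (Lp ℂ p ν))) (Q : ℂ[X]) :
    IsMultiplier M (fun z => Complex.exp (-Q.eval (z : ℂ))) := by
  obtain ⟨R, hR⟩ := isCompact_univ.exists_bound_of_continuousOn
    (f := fun z : Circle => Q.eval (z : ℂ)) (by fun_prop)
  refine IsMultiplier.of_bounded_tendsto hp hM (C := Real.exp R)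
    (k := fun n z => (1 + -Q.eval (z : ℂ) / n) ^ n) (fun n f hf => ?_)
    (fun n => Eventually.of_forall fun z => ?_)
    (Eventually.of_forall fun z => Complex.tendsto_one_add_div_pow_exp _)
  · refine (hf.eval_mul hz ((1 + C (-(n : ℂ)⁻¹) * Q) ^ n)).congr (Eventually.of_forall fun z => ?_)
    simp only [eval_pow, eval_add, eval_one, Polynomial.eval_mul, eval_C]
    ring
  · refine (norm_one_add_div_pow_le_exp _ n).trans (Real.exp_le_exp.2 ?_)
    rw [norm_neg]
    exact hR z trivial

theorem isMultiplier_exp_neg_of_tendsto (hp : p ≠ ∞) (hM : IsClosed (M : Set (Lp ℂ p ν)))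
    (hz : ZInvariant (M : Set (Lp ℂ p ν))) {Q : ℕ → ℂ[X]} {q : Circle → ℂ}
    (hQ : ∀ n (z : Circle), 0 ≤ ((Q n).eval (z : ℂ)).re)
    (hlim : ∀ᵐ z : Circle ∂ν, Tendsto (fun n => (Q n).eval (z : ℂ)) atTop (𝓝 (q z))) :
    IsMultiplier M (fun z => Complex.exp (-q z)) := by
  refine IsMultiplier.of_bounded_tendsto hp hM (C := 1)
    (fun n => isMultiplier_exp_neg_eval hp hM hz (Q n))
    (fun n => Eventually.of_forall fun z => ?_) ?_
  · rw [Complex.norm_exp, Complex.neg_re, Real.exp_le_one_iff, neg_nonpos]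
    exact hQ n z
  · filter_upwards [hlim] with z h using h.neg.cexp

theorem exp_neg_sqrt_div_mul_le {c : ℝ} (hc : 0 < c) (x : ℝ) :
    Real.exp (-(√x / c)) * x ≤ 2 * c ^ 2 := by
  rcases le_total x 0 with hx | hx
  · exact (mul_nonpos_of_nonneg_of_nonpos (Real.exp_nonneg _) hx).trans (by positivity)
  · rw [Real.exp_neg, inv_mul_le_iff₀ (Real.exp_pos _)]
    calc x = c ^ 2 * (√x / c) ^ 2 := by
          rw [div_pow, Real.sq_sqrt hx]
          field_simp
      _ ≤ c ^ 2 * (2 * Real.exp (√x / c)) := by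
          have hquad := Real.quadratic_le_exp_of_nonneg (x := √x / c) (by positivity)
          have : 0 ≤ √x / c := by positivity
          gcongr
          linarith
      _ = Real.exp (√x / c) * (2 * c ^ 2) := by ring

theorem memLp_two_sqrt {α : Type*} [MeasurableSpace α] {μ : Measure α} {F : α → ℝ}
    (hF : Integrable F μ) : MemLp (fun x => √(F x)) 2 μ := by
  have hm : AEStronglyMeasurable (fun x => √(F x)) μ :=
    Real.continuous_sqrt.comp_aestronglyMeasurable hF.aestronglyMeasurable
  rw [memLp_two_iff_integrable_sq hm]
  refine hF.norm.mono' (hm.pow 2) (Eventually.of_forall fun x => ?_)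
  rw [Real.norm_of_nonneg (by positivity), ← Real.sqrt_le_sqrt_iff (norm_nonneg _),
    Real.sqrt_sq (Real.sqrt_nonneg _)]
  exact Real.sqrt_le_sqrt (Real.le_norm_self _)

theorem exists_truncating_multipliers (hp : p ≠ ∞) {M : Submodule ℂ (Lp ℂ p arc)}
    (hM : IsClosed (M : Set (Lp ℂ p arc))) (hz : ZInvariant (M : Set (Lp ℂ p arc)))
    {F : Circle → ℝ} (hF : Integrable F arc) :
    ∃ k : ℕ → Circle → ℂ, (∀ n, IsMultiplier M (k n)) ∧ (∀ n, ∀ᵐ z ∂arc, ‖k n z‖ ≤ 1) ∧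
      (∀ n, ∃ C : ℝ, ∀ᵐ z ∂arc, ‖k n z‖ * F z ≤ C) ∧
      ∀ᵐ z ∂arc, Tendsto (fun n => k n z) atTop (𝓝 1) := by
  obtain ⟨q, Q, hQ, hq, hlim⟩ :=
    exists_analytic_completion (memLp_two_sqrt hF) fun z => Real.sqrt_nonneg _
  have hnorm (n : ℕ) : ∀ᵐ z ∂arc,
      ‖Complex.exp (-(q z / (n + 1 : ℕ)))‖ = Real.exp (-(√(F z) / (n + 1 : ℕ))) := by
    filter_upwards [hq] with z hz
    rw [Complex.norm_exp, Complex.neg_re, Complex.div_natCast_re, hz]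
  refine ⟨fun n z => Complex.exp (-(q z / (n + 1 : ℕ))), fun n => ?_, fun n => ?_,
    fun n => ⟨2 * (n + 1 : ℕ) ^ 2, ?_⟩, Eventually.of_forall fun z => ?_⟩
  · refine isMultiplier_exp_neg_of_tendsto hp hM hz
      (Q := fun j => Q j * C ((n + 1 : ℕ) : ℂ)⁻¹) (fun j z => ?_) ?_
    · rw [Polynomial.eval_mul, eval_C, ← div_eq_mul_inv, Complex.div_natCast_re]
      exact div_nonneg (hQ j z) (Nat.cast_nonneg _)
    · filter_upwards [hlim] with z h
      simpa only [Polynomial.eval_mul, eval_C, div_eq_mul_inv] using h.mul_const _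
  · filter_upwards [hnorm n] with z hz
    rw [hz, Real.exp_le_one_iff, neg_nonpos]
    positivity
  · filter_upwards [hnorm n] with z hz
    rw [hz]
    exact exp_neg_sqrt_div_mul_le (by positivity) _
  · have hdiv : Tendsto (fun n : ℕ => q z / (n + 1 : ℕ)) atTop (𝓝 0) :=
      (tendsto_const_div_atTop_nhds_zero_nat (q z)).comp (tendsto_add_atTop_nat 1)
    simpa only [neg_zero, Complex.exp_zero] using hdiv.neg.cexp

theorem HasRep.of_mem_closure (hp : p ≠ ∞) {M : Submodule ℂ (Lp ℂ p arc)}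
    (hM : IsClosed (M : Set (Lp ℂ p arc))) (hz : ZInvariant (M : Set (Lp ℂ p arc)))
    {q : ℝ≥0∞} [Fact (1 ≤ q)] {S : Set (Lp ℂ q arc)} (hS : ∀ f ∈ S, HasRep M f)
    {g : Lp ℂ q arc} (hg : g ∈ closure S) (hgp : MemLp g p arc) : HasRep M g := by
  obtain ⟨f, F, hfS, hF, hfF, hfg⟩ := exists_seq_dominated_of_mem_closure hg
  obtain ⟨k, hk, hk1, hkF, hklim⟩ :=
    exists_truncating_multipliers hp hM hz (hF.integrable Fact.out)
  have hkg (n : ℕ) : HasRep M (fun z => k n z * g z) := by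
    obtain ⟨C, hC⟩ := hkF n
    refine HasRep.of_dominated hp hM (fun j => hk n _ (hS _ (hfS j))) (memLp_const C)
      (fun j => ?_) ?_
    · filter_upwards [hfF j, hC] with z hfz hCz
      rw [norm_mul]
      exact (mul_le_mul_of_nonneg_left hfz (norm_nonneg _)).trans hCz
    · filter_upwards [hfg] with z h using h.const_mul _
  exact HasRep.of_mul_tendsto_one hp hM hgp hkg hk1 hklim

end Multipliers

section UnimodularMultiplication

theorem ZInvariant.map_weightedMul {μ ν : Measure Circle} {p : ℝ≥0∞} [Fact (1 ≤ p)] {w : Circle → ℂ}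
    (hp : p ≠ ∞) (hw : Measurable w) (hμ : ν.withDensity (fun x => ‖w x‖ₑ ^ p.toReal) = μ)
    {W : Submodule ℂ (Lp ℂ p μ)} (hz : ZInvariant (W : Set (Lp ℂ p μ))) :
    ZInvariant (W.map (weightedMul hp hw hμ).toLinearMap : Set (Lp ℂ p ν)) := by
  rintro _ ⟨f, hf, rfl⟩
  obtain ⟨k, hk, hkf⟩ := hz f hf
  refine ⟨_, ⟨k, hk, rfl⟩, ?_⟩
  filter_upwards [coeFn_weightedMul hp hw hμ k, coeFn_weightedMul hp hw hμ f,
    mul_ae_eq_mul_of_withDensity hp hw hμ hkf] with z hk hf hkf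
  refine hk.trans (hkf.trans ?_)
  rw [mul_left_comm, ← hf]
  rfl

theorem unimodular_coe : Unimodular (fun z : Circle => (z : ℂ)) :=
  ⟨Continuous.measurable (by fun_prop), Eventually.of_forall Circle.norm_coe⟩

variable {p : ℝ≥0∞} {φ : Circle → ℂ}

theorem Unimodular.withDensity_eq (hφ : Unimodular φ) :
    arc.withDensity (fun z => ‖φ z‖ₑ ^ p.toReal) = arc := by
  conv_rhs => rw [← withDensity_one (μ := arc)]
  refine withDensity_congr_ae ?_
  filter_upwards [hφ.2] with z hz
  rw [← ofReal_norm, hz, ENNReal.ofReal_one, ENNReal.one_rpow, Pi.one_apply]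

theorem Unimodular.memLp_conj_mul (hφ : Unimodular φ) {f : Circle → ℂ} (hf : MemLp f p arc) :
    MemLp (fun z => conj (φ z) * f z) p arc := by
  refine hf.congr_norm
    ((Complex.continuous_conj.measurable.comp hφ.1).aestronglyMeasurable.mul hf.1) ?_
  filter_upwards [hφ.2] with z hz
  rw [norm_mul, RCLike.norm_conj, hz, one_mul]

variable [Fact (1 ≤ p)] (hp : p ≠ ∞)

/-- Multiplication by a unimodular function, as an isometry of `L^p` of the circle. -/
def unimodularMul (hφ : Unimodular φ) : Lp ℂ p arc →ₗᵢ[ℂ] Lp ℂ p arc :=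
  weightedMul hp hφ.1 hφ.withDensity_eq

/-- The subspace `φM = {φ f : f ∈ M}`. -/
def unimodularImage (hφ : Unimodular φ) (M : Submodule ℂ (Lp ℂ p arc)) :
    Submodule ℂ (Lp ℂ p arc) :=
  M.map (unimodularMul hp hφ).toLinearMap

variable {M : Submodule ℂ (Lp ℂ p arc)}

theorem isClosed_unimodularImage (hφ : Unimodular φ) (hM : IsClosed (M : Set (Lp ℂ p arc))) :
    IsClosed (unimodularImage hp hφ M : Set (Lp ℂ p arc)) :=
  isClosed_map_weightedMul hp hφ.1 hφ.withDensity_eq hM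

theorem zInvariant_unimodularImage (hφ : Unimodular φ) (hz : ZInvariant (M : Set (Lp ℂ p arc))) :
    ZInvariant (unimodularImage hp hφ M : Set (Lp ℂ p arc)) :=
  hz.map_weightedMul hp hφ.1 hφ.withDensity_eq

/-- The shift `f ↦ z f` on `L^p` of the circle. -/
def shift : Lp ℂ p arc →ₗᵢ[ℂ] Lp ℂ p arc :=
  unimodularMul hp unimodular_coe

theorem coeFn_shift (f : Lp ℂ p arc) : shift hp f =ᵐ[arc] fun z => (z : ℂ) * f z :=
  coeFn_weightedMul hp unimodular_coe.1 unimodular_coe.withDensity_eq f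

/-- The subspace `zM = {z f : f ∈ M}`. -/
def shiftImage (M : Submodule ℂ (Lp ℂ p arc)) : Submodule ℂ (Lp ℂ p arc) :=
  unimodularImage hp unimodular_coe M

theorem isClosed_shiftImage (hM : IsClosed (M : Set (Lp ℂ p arc))) :
    IsClosed (shiftImage hp M : Set (Lp ℂ p arc)) :=
  isClosed_unimodularImage hp unimodular_coe hM

theorem zInvariant_iff_shiftImage_le :
    ZInvariant (M : Set (Lp ℂ p arc)) ↔ shiftImage hp M ≤ M := by
  rw [shiftImage, unimodularImage, Submodule.map_le_iff_le_comap]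
  refine ⟨fun hz f hf => ?_, fun h f hf => ⟨shift hp f, h hf, coeFn_shift hp f⟩⟩
  rw [Submodule.mem_comap, ← hasRep_coeFn_iff]
  exact ((hasRep_coeFn_iff.2 hf).coe_mul hz).congr (coeFn_shift hp f).symm

include hp in
theorem ZInvariant.topologicalClosure (hz : ZInvariant (M : Set (Lp ℂ p arc))) :
    ZInvariant (M.topologicalClosure : Set (Lp ℂ p arc)) := by
  rw [zInvariant_iff_shiftImage_le hp, shiftImage, unimodularImage,
    Submodule.map_le_iff_le_comap] at hz ⊢
  refine M.topologicalClosure_minimal (hz.trans (Submodule.comap_mono M.le_topologicalClosure)) ?_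
  exact M.isClosed_topologicalClosure.preimage (shift hp).continuous

theorem hasRep_unimodularImage_iff (hφ : Unimodular φ) {f : Circle → ℂ} :
    HasRep (unimodularImage hp hφ M) f ↔
      HasRep M (fun z => conj (φ z) * f z) := by
  have hconj : ∀ᵐ z ∂arc, conj (φ z) * φ z = 1 := by
    filter_upwards [hφ.2] with z hz
    rw [Complex.conj_mul', hz, Complex.ofReal_one, one_pow]
  refine (hasRep_map_weightedMul_iff hp hφ.1 _).trans (exists_congr fun h => and_congr_right ?_)
  refine fun _ => ⟨fun hf => ?_, fun hf => ?_⟩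
  · filter_upwards [hf, hconj] with z hf hc
    rw [hf, ← mul_assoc, hc, one_mul]
  · filter_upwards [hf, hconj] with z hf hc
    rw [hf, ← mul_assoc, mul_comm (φ z), hc, one_mul]

theorem hasRep_unimodularImage_mul_iff (hφ : Unimodular φ) {f : Circle → ℂ} :
    HasRep (unimodularImage hp hφ M) (fun z => φ z * f z) ↔ HasRep M f := by
  rw [hasRep_unimodularImage_iff hp hφ]
  have hconj : (fun z => conj (φ z) * (φ z * f z)) =ᵐ[arc] f := by
    filter_upwards [hφ.2] with z hz
    rw [← mul_assoc, Complex.conj_mul', hz, Complex.ofReal_one, one_pow, one_mul]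
  exact ⟨fun h => h.congr hconj, fun h => h.congr hconj.symm⟩

theorem hasRep_shiftImage_coe_pow_succ_mul (hz : ZInvariant (M : Set (Lp ℂ p arc)))
    {f : Circle → ℂ} (hf : HasRep M f) (n : ℕ) :
    HasRep (shiftImage hp M) (fun z => (z : ℂ) ^ (n + 1) * f z) := by
  simp only [pow_succ', mul_assoc]
  exact (hasRep_unimodularImage_mul_iff hp unimodular_coe).2 (hf.coe_pow_mul hz n)

theorem HasRep.coe_zpow_mul (hM : shiftImage hp M = M) {f : Circle → ℂ} (hf : HasRep M f) (n : ℤ) :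
    HasRep M (fun z => (z : ℂ) ^ n * f z) := by
  have hz : ZInvariant (M : Set (Lp ℂ p arc)) := (zInvariant_iff_shiftImage_le hp).2 hM.le
  induction n with
  | zero => simpa using hf
  | succ n _ => exact_mod_cast hf.coe_pow_mul hz (n + 1)
  | pred n ih =>
    rw [← hM] at ih
    refine ((hasRep_unimodularImage_iff hp unimodular_coe).1 ih).congr
      (Eventually.of_forall fun z => ?_)
    change conj (z : ℂ) * ((z : ℂ) ^ (-n : ℤ) * f z) = (z : ℂ) ^ (-n - 1 : ℤ) * f z
    rw [zpow_sub_one₀ (Circle.coe_ne_zero _), ← Circle.coe_inv_eq_conj, Circle.coe_inv]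
    ring

end UnimodularMultiplication

section ExponentChange

variable {p q : ℝ≥0∞}

/-- The elements of `L^q` which also belong to the subspace `M` of `L^p`. -/
def interLp (q : ℝ≥0∞) (M : Submodule ℂ (Lp ℂ p arc)) : Submodule ℂ (Lp ℂ q arc) where
  carrier := {f | HasRep M f}
  add_mem' hf hg := (hf.add hg).congr (Lp.coeFn_add _ _).symm
  zero_mem' := ⟨0, M.zero_mem, (Lp.coeFn_zero ..).trans (Lp.coeFn_zero ..).symm⟩
  smul_mem' c f hf := (hf.const_mul c).congr (Lp.coeFn_smul c f).symm

variable [Fact (1 ≤ q)] {M N : Submodule ℂ (Lp ℂ p arc)}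

theorem zInvariant_interLp (hq : q ≠ ∞) (hz : ZInvariant (M : Set (Lp ℂ p arc))) :
    ZInvariant (interLp q M : Set (Lp ℂ q arc)) := fun f hf =>
  ⟨shift hq f, (HasRep.coe_mul hz hf).congr (coeFn_shift hq f).symm, coeFn_shift hq f⟩

variable [Fact (1 ≤ p)]

theorem hasRep_topologicalClosure_interLp_iff (hp : p ≠ ∞) (hM : IsClosed (M : Set (Lp ℂ p arc)))
    (hz : ZInvariant (M : Set (Lp ℂ p arc))) {f : Circle → ℂ} (hfp : MemLp f p arc)
    (hfq : MemLp f q arc) : HasRep (interLp q M).topologicalClosure f ↔ HasRep M f := by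
  rw [hasRep_iff_toLp_mem hfq]
  refine ⟨fun hf => ?_, fun hf => Submodule.le_topologicalClosure _ (hf.congr hfq.coeFn_toLp.symm)⟩
  exact (HasRep.of_mem_closure hp hM hz (S := interLp q M) (fun _ h => h) hf
    ((memLp_congr_ae hfq.coeFn_toLp).2 hfp)).congr hfq.coeFn_toLp

theorem le_of_forall_bounded (hp : p ≠ ∞) (hM : IsClosed (M : Set (Lp ℂ p arc)))
    (hMz : ZInvariant (M : Set (Lp ℂ p arc))) (hN : IsClosed (N : Set (Lp ℂ p arc)))
    (h : ∀ f, MemLp f ∞ arc → HasRep M f → HasRep N f) : M ≤ N := by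
  intro g hg
  have hg' := Lp.memLp g
  obtain ⟨k, hk, hk1, hkb, hklim⟩ :=
    exists_truncating_multipliers hp hM hMz (hg'.norm.integrable Fact.out)
  have hkg (n : ℕ) : HasRep N (fun z => k n z * g z) := by
    obtain ⟨C, hC⟩ := hkb n
    have hMkg := hk n _ (hasRep_coeFn_iff.2 hg)
    refine h _ (memLp_top_of_bound hMkg.memLp.aestronglyMeasurable C ?_) hMkg
    simpa only [norm_mul] using hC
  exact hasRep_coeFn_iff.1 (HasRep.of_mul_tendsto_one hp hN hg' hkg hk1 hklim)

theorem eq_of_forall_bounded (hp : p ≠ ∞) (hM : IsClosed (M : Set (Lp ℂ p arc)))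
    (hMz : ZInvariant (M : Set (Lp ℂ p arc))) (hN : IsClosed (N : Set (Lp ℂ p arc)))
    (hNz : ZInvariant (N : Set (Lp ℂ p arc)))
    (h : ∀ f, MemLp f ∞ arc → (HasRep M f ↔ HasRep N f)) : M = N :=
  le_antisymm (le_of_forall_bounded hp hM hMz hN fun f hf => (h f hf).1)
    (le_of_forall_bounded hp hN hNz hM fun f hf => (h f hf).2)

end ExponentChange

section VanishingOff

variable {α : Type*} [MeasurableSpace α] {μ : Measure α} {p : ℝ≥0∞} {E : Set α}

/-- The subspace `χ_E L^p(μ)` of the elements of `L^p(μ)` which vanish outside `E`. -/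
def vanishingOff (p : ℝ≥0∞) (μ : Measure α) (E : Set α) : Submodule ℂ (Lp ℂ p μ) where
  carrier := {f | ∀ᵐ x ∂μ, x ∉ E → f x = 0}
  add_mem' {f g} hf hg := by
    rw [Set.mem_ofPred_eq] at hf hg ⊢
    filter_upwards [Lp.coeFn_add f g, hf, hg] with x h hf hg hx
    rw [h, Pi.add_apply, hf hx, hg hx, add_zero]
  zero_mem' := by
    filter_upwards [Lp.coeFn_zero ℂ p μ] with x h _ using h
  smul_mem' c f hf := by
    rw [Set.mem_ofPred_eq] at hf ⊢
    filter_upwards [Lp.coeFn_smul c f, hf] with x h hf hx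
    rw [h, Pi.smul_apply, hf hx, smul_zero]

theorem mem_vanishingOff_iff {f : Lp ℂ p μ} :
    f ∈ vanishingOff p μ E ↔ ∀ᵐ x ∂μ, x ∉ E → f x = 0 := Iff.rfl

theorem hasRep_vanishingOff_iff {f : α → ℂ} (hf : MemLp f p μ) :
    HasRep (vanishingOff p μ E) f ↔ ∀ᵐ x ∂μ, x ∉ E → f x = 0 := by
  rw [hasRep_iff_toLp_mem hf, mem_vanishingOff_iff]
  refine eventually_congr ?_
  filter_upwards [hf.coeFn_toLp] with x hx
  rw [hx]

theorem isClosed_vanishingOff [Fact (1 ≤ p)] : IsClosed (vanishingOff p μ E : Set (Lp ℂ p μ)) := by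
  refine isClosed_of_closure_subset fun g hg => ?_
  obtain ⟨f, -, hf, -, -, hfg⟩ := exists_seq_dominated_of_mem_closure hg
  filter_upwards [ae_all_iff.2 hf, hfg] with x hf hfg hx
  simp only [hf _ hx] at hfg
  exact tendsto_nhds_unique hfg tendsto_const_nhds

theorem zInvariant_vanishingOff [Fact (1 ≤ p)] (hp : p ≠ ∞) (E : Set Circle) :
    ZInvariant (vanishingOff p arc E : Set (Lp ℂ p arc)) := by
  refine fun f hf => ⟨shift hp f, ?_, coeFn_shift hp f⟩
  rw [SetLike.mem_coe, mem_vanishingOff_iff] at hf ⊢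
  filter_upwards [coeFn_shift hp f, hf] with z h hf hz
  rw [h, hf hz, mul_zero]

end VanishingOff

section HardySubmodule

/-- The polynomials in `z`, as a subspace of `L^p(ν)`. -/
def polynomialSubmodule (p : ℝ≥0∞) (ν : Measure Circle) : Submodule ℂ (Lp ℂ p ν) where
  carrier := {f | ∃ P : ℂ[X], ∀ᵐ z ∂ν, f z = P.eval (z : ℂ)}
  add_mem' := by
    rintro f g ⟨P, hP⟩ ⟨Q, hQ⟩
    refine ⟨P + Q, ?_⟩
    filter_upwards [Lp.coeFn_add f g, hP, hQ] with z h hP hQ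
    rw [h, Pi.add_apply, hP, hQ, eval_add]
  zero_mem' := by
    refine ⟨0, ?_⟩
    filter_upwards [Lp.coeFn_zero ℂ p ν] with z h
    rw [h, Pi.zero_apply, eval_zero]
  smul_mem' := by
    rintro c f ⟨P, hP⟩
    refine ⟨c • P, ?_⟩
    filter_upwards [Lp.coeFn_smul c f, hP] with z h hP
    rw [h, Pi.smul_apply, hP, eval_smul]

/-- The Hardy space `hardy p ν` as a subspace of `L^p(ν)`. -/
def hardySubmodule (p : ℝ≥0∞) [Fact (1 ≤ p)] (ν : Measure Circle) : Submodule ℂ (Lp ℂ p ν) :=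
  (polynomialSubmodule p ν).topologicalClosure

theorem coe_hardySubmodule (p : ℝ≥0∞) [Fact (1 ≤ p)] (ν : Measure Circle) :
    (hardySubmodule p ν : Set (Lp ℂ p ν)) = hardy p ν := rfl

theorem isClosed_hardySubmodule (p : ℝ≥0∞) [Fact (1 ≤ p)] (ν : Measure Circle) :
    IsClosed (hardySubmodule p ν : Set (Lp ℂ p ν)) :=
  Submodule.isClosed_topologicalClosure _

variable {p : ℝ≥0∞} [Fact (1 ≤ p)]

theorem hasRep_hardySubmodule_eval (P : ℂ[X]) :
    HasRep (hardySubmodule p arc) (fun z => P.eval (z : ℂ)) := by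
  have hP : MemLp (fun z : Circle => P.eval (z : ℂ)) p arc :=
    memLp_arc_of_continuous (by fun_prop) p
  exact (hasRep_iff_toLp_mem hP).2 (Submodule.le_topologicalClosure _ ⟨P, hP.coeFn_toLp⟩)

theorem zInvariant_hardySubmodule (hp : p ≠ ∞) :
    ZInvariant (hardySubmodule p arc : Set (Lp ℂ p arc)) := by
  refine ZInvariant.topologicalClosure hp fun f hf => ⟨shift hp f, ?_, coeFn_shift hp f⟩
  obtain ⟨P, hP⟩ := hf
  refine ⟨X * P, ?_⟩
  filter_upwards [coeFn_shift hp f, hP] with z hz hP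
  rw [hz, hP, Polynomial.eval_mul, eval_X]

theorem HasRep.hardySubmodule_exponent {q : ℝ≥0∞} [Fact (1 ≤ q)] (hp : p ≠ ∞) {f : Circle → ℂ}
    (hf : HasRep (hardySubmodule q arc) f) (hfp : MemLp f p arc) :
    HasRep (hardySubmodule p arc) f := by
  obtain ⟨g, hg, hgf⟩ := hf
  refine (HasRep.of_mem_closure hp (isClosed_hardySubmodule p arc) (zInvariant_hardySubmodule hp)
    (fun k hk => ?_) hg ((memLp_congr_ae hgf).2 hfp)).congr hgf
  obtain ⟨P, hP⟩ := hk
  exact (hasRep_hardySubmodule_eval P).congr (EventuallyEq.symm hP)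

end HardySubmodule

section Orthogonality

theorem eq_of_le_of_forall_mem_orthogonal {𝕜 V : Type*} [RCLike 𝕜] [NormedAddCommGroup V]
    [InnerProductSpace 𝕜 V] {K₁ K₂ : Submodule 𝕜 V} [K₁.HasOrthogonalProjection] (hle : K₁ ≤ K₂)
    (h : ∀ s ∈ K₂, s ∈ K₁ᗮ → s = 0) : K₁ = K₂ := by
  have hbot : K₁ᗮ ⊓ K₂ = ⊥ := (Submodule.eq_bot_iff _).2 fun s hs => h s hs.2 hs.1
  rw [← Submodule.sup_orthogonal_inf_of_hasOrthogonalProjection hle, hbot, sup_bot_eq]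

theorem exists_norm_eq_one_mem_orthogonal {𝕜 V : Type*} [RCLike 𝕜] [NormedAddCommGroup V]
    [InnerProductSpace 𝕜 V] {K₁ K₂ : Submodule 𝕜 V} [K₁.HasOrthogonalProjection] (hlt : K₁ < K₂) :
    ∃ r ∈ K₂, r ∈ K₁ᗮ ∧ ‖r‖ = 1 := by
  by_contra! hno
  refine hlt.ne (eq_of_le_of_forall_mem_orthogonal hlt.le fun s hs hs' => ?_)
  by_contra hs0
  exact hno _ (K₂.smul_mem (‖s‖ : 𝕜)⁻¹ hs) (K₁ᗮ.smul_mem _ hs') (norm_smul_inv_norm hs0)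

theorem integral_mul_conj_eq_zero {α : Type*} [MeasurableSpace α] {μ : Measure α}
    {K : Submodule ℂ (Lp ℂ 2 μ)} {r : Lp ℂ 2 μ} (hr : r ∈ Kᗮ) {f : α → ℂ} (hf : HasRep K f) :
    ∫ x, f x * conj (r x) ∂μ = 0 := by
  obtain ⟨h, hK, hf⟩ := hf
  rw [← (Submodule.mem_orthogonal' K r).1 hr h hK, L2.inner_def]
  refine integral_congr_ae ?_
  filter_upwards [hf] with x hx
  rw [RCLike.inner_apply, hx]

theorem integrable_mul_conj {α : Type*} [MeasurableSpace α] {μ : Measure α} (f g : Lp ℂ 2 μ) :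
    Integrable (fun x => f x * conj (g x)) μ := by
  simpa only [RCLike.inner_apply] using L2.integrable_inner (𝕜 := ℂ) g f

end Orthogonality

section SquareIntegrable

variable {K : Submodule ℂ (Lp ℂ 2 arc)}

theorem mul_conj_ae_eq_zero_of_mem_orthogonal (hS : shiftImage ENNReal.ofNat_ne_top K = K)
    {f r : Lp ℂ 2 arc} (hf : f ∈ K) (hr : r ∈ Kᗮ) : (fun z => f z * conj (r z)) =ᵐ[arc] 0 := by
  refine ae_eq_zero_of_forall_integral_mul_zpow_eq_zero (integrable_mul_conj f r) fun n => ?_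
  rw [← integral_mul_conj_eq_zero hr ((hasRep_coeFn_iff.2 hf).coe_zpow_mul _ hS n)]
  congr with z
  ring

theorem exists_eq_vanishingOff_of_shiftImage_eq (hK : IsClosed (K : Set (Lp ℂ 2 arc)))
    (hS : shiftImage ENNReal.ofNat_ne_top K = K) :
    ∃ E : Set Circle, MeasurableSet E ∧ K = vanishingOff 2 arc E := by
  have : CompleteSpace K := hK.completeSpace_coe
  let one : Lp ℂ 2 arc := Lp.const 2 arc 1
  let q : Lp ℂ 2 arc := K.starProjection one
  have hq : q ∈ K := K.starProjection_apply_mem one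
  have hq' : one - q ∈ Kᗮ := K.sub_starProjection_mem_orthogonal one
  refine ⟨{z | q z ≠ 0}, (Lp.stronglyMeasurable q).measurable (measurableSet_singleton 0).compl,
    eq_of_le_of_forall_mem_orthogonal (fun f hf => ?_) fun s hs hs' => ?_⟩
  · rw [mem_vanishingOff_iff]
    filter_upwards [mul_conj_ae_eq_zero_of_mem_orthogonal hS hf hq', Lp.coeFn_sub one q,
      Lp.coeFn_const (p := 2) (μ := arc) (1 : ℂ)] with z h hsub hone hz
    have hz0 : q z = 0 := not_not.1 hz
    rw [hsub, Pi.sub_apply, hone, hz0] at h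
    simpa using h
  · rw [Lp.eq_zero_iff_ae_eq_zero]
    filter_upwards [mul_conj_ae_eq_zero_of_mem_orthogonal hS hq hs', hs] with z h hsz
    by_cases hz : q z = 0
    · exact hsz (not_not.2 hz)
    · simpa [hz] using h

theorem ae_eq_integral_of_forall_integral_pow_succ_mul_eq_zero {g : Circle → ℂ}
    (hg : Integrable g arc) (hreal : ∀ z, conj (g z) = g z)
    (h : ∀ n : ℕ, ∫ z : Circle, (z : ℂ) ^ (n + 1) * g z ∂arc = 0) :
    ∀ᵐ z ∂arc, g z = ∫ z, g z ∂arc := by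
  have hpow (n : ℤ) : Integrable (fun z : Circle => (z : ℂ) ^ n) arc :=
    integrable_arc_of_continuous (monomialMap n).continuous
  have hint (n : ℤ) : Integrable (fun z : Circle => g z * (z : ℂ) ^ n) arc :=
    hg.mul_bdd (c := 1) (monomialMap n).continuous.aestronglyMeasurable
      (Eventually.of_forall fun z => by
        rw [norm_zpow, Circle.norm_coe, one_zpow])
  have hcoeff (n : ℤ) : n ≠ 0 → ∫ z : Circle, g z * (z : ℂ) ^ n ∂arc = 0 := by
    intro hn
    obtain ⟨m, rfl | rfl⟩ := n.eq_nat_or_neg <;>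
      obtain ⟨k, rfl⟩ := Nat.exists_eq_succ_of_ne_zero (by simpa using hn : m ≠ 0)
    · simpa only [zpow_natCast, mul_comm] using h k
    · have hk := congr_arg conj (h k)
      rw [← integral_conj, map_zero] at hk
      rw [← hk]
      congr with z
      rw [map_mul, hreal, ← zpow_natCast, conj_coe_zpow, mul_comm]
  have hsub : (fun z => g z - ∫ z, g z ∂arc) =ᵐ[arc] 0 := by
    refine ae_eq_zero_of_forall_integral_mul_zpow_eq_zero (hg.sub (integrable_const _)) fun n => ?_
    simp only [sub_mul]
    rw [integral_sub (hint n) ((hpow n).const_mul _), integral_const_mul]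
    rcases eq_or_ne n 0 with rfl | hn
    · simp
    · rw [hcoeff n hn, integral_zpow_arc hn, mul_zero, sub_zero]
  filter_upwards [hsub] with z hz using sub_eq_zero.1 hz

theorem norm_ae_eq_one_of_mem_orthogonal_shiftImage (hz : ZInvariant (K : Set (Lp ℂ 2 arc)))
    {r : Lp ℂ 2 arc} (hr : r ∈ K) (hrS : r ∈ (shiftImage ENNReal.ofNat_ne_top K)ᗮ) (hr1 : ‖r‖ = 1) :
    ∀ᵐ z ∂arc, ‖r z‖ = 1 := by
  have hcoeff (n : ℕ) : ∫ z : Circle, (z : ℂ) ^ (n + 1) * (r z * conj (r z)) ∂arc = 0 := by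
    simpa only [mul_assoc] using integral_mul_conj_eq_zero hrS
      (hasRep_shiftImage_coe_pow_succ_mul _ hz (hasRep_coeFn_iff.2 hr) n)
  have hmean : ∫ z, r z * conj (r z) ∂arc = 1 := by
    have hinner := L2.inner_def (𝕜 := ℂ) r r
    rw [inner_self_eq_norm_sq_to_K, hr1] at hinner
    simpa only [RCLike.inner_apply, RCLike.ofReal_one, one_pow] using hinner.symm
  filter_upwards [ae_eq_integral_of_forall_integral_pow_succ_mul_eq_zero
    (integrable_mul_conj r r) (fun z => by simp [mul_comm]) hcoeff] with z h
  rw [hmean, Complex.mul_conj'] at h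
  exact (pow_eq_one_iff_of_nonneg (norm_nonneg _) two_ne_zero).1 (by exact_mod_cast h)

theorem unimodularImage_hardySubmodule_le {p : ℝ≥0∞} [Fact (1 ≤ p)] (hp : p ≠ ∞)
    {M : Submodule ℂ (Lp ℂ p arc)} (hM : IsClosed (M : Set (Lp ℂ p arc)))
    (hz : ZInvariant (M : Set (Lp ℂ p arc))) {φ : Circle → ℂ} (hφ : Unimodular φ)
    (hφM : HasRep M φ) :
    unimodularImage hp hφ (hardySubmodule p arc) ≤ M := by
  rw [unimodularImage, Submodule.map_le_iff_le_comap]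
  refine Submodule.topologicalClosure_minimal _ ?_ (hM.preimage (unimodularMul hp hφ).continuous)
  rintro f ⟨P, hP⟩
  rw [Submodule.mem_comap, ← hasRep_coeFn_iff]
  refine (hφM.eval_mul hz P).congr ?_
  filter_upwards [coeFn_weightedMul hp hφ.1 hφ.withDensity_eq f, hP] with z h hP
  refine Eq.trans ?_ h.symm
  rw [hP, mul_comm]

theorem eq_zero_of_mem_orthogonal_unimodularImage_hardySubmodule
    (hz : ZInvariant (K : Set (Lp ℂ 2 arc)))
    {r s : Lp ℂ 2 arc} (hr : Unimodular r) (hrS : r ∈ (shiftImage ENNReal.ofNat_ne_top K)ᗮ)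
    (hs : s ∈ K)
    (hsr : s ∈ (unimodularImage ENNReal.ofNat_ne_top hr (hardySubmodule 2 arc))ᗮ) :
    s = 0 := by
  have hcoeff (n : ℤ) : ∫ z : Circle, s z * conj (r z) * (z : ℂ) ^ n ∂arc = 0 := by
    rcases lt_or_ge 0 n with hn | hn
    · obtain ⟨m, rfl⟩ := Int.eq_succ_of_zero_lt hn
      rw [← integral_mul_conj_eq_zero hrS
        (hasRep_shiftImage_coe_pow_succ_mul _ hz (hasRep_coeFn_iff.2 hs) m)]
      congr with z
      rw [← zpow_natCast, Nat.cast_add_one]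
      ring
    · obtain ⟨m, rfl⟩ := Int.exists_eq_neg_ofNat hn
      have hpow := hasRep_hardySubmodule_eval (p := 2) (X ^ m)
      have h := congr_arg conj (integral_mul_conj_eq_zero hsr
        ((hasRep_unimodularImage_mul_iff _ hr).2 hpow))
      rw [← integral_conj, map_zero] at h
      rw [← h]
      congr with z
      simp only [map_mul, eval_pow, eval_X, Complex.conj_conj]
      rw [← zpow_natCast, conj_coe_zpow]
      ring
  rw [Lp.eq_zero_iff_ae_eq_zero]
  filter_upwards [hr.2, ae_eq_zero_of_forall_integral_mul_zpow_eq_zero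
    (integrable_mul_conj s r) hcoeff] with z hr h
  have hr0 : r z ≠ 0 := norm_ne_zero_iff.1 (by simp [hr])
  simpa [hr0] using h

theorem exists_eq_unimodularImage_of_shiftImage_ne (hK : IsClosed (K : Set (Lp ℂ 2 arc)))
    (hz : ZInvariant (K : Set (Lp ℂ 2 arc))) (hS : shiftImage ENNReal.ofNat_ne_top K ≠ K) :
    ∃ (φ : Circle → ℂ) (hφ : Unimodular φ),
      K = unimodularImage ENNReal.ofNat_ne_top hφ (hardySubmodule 2 arc) := by
  have hle := (zInvariant_iff_shiftImage_le (p := 2) ENNReal.ofNat_ne_top).1 hz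
  have := (isClosed_shiftImage ENNReal.ofNat_ne_top hK).completeSpace_coe
  obtain ⟨r, hr, hrS, hr1⟩ := exists_norm_eq_one_mem_orthogonal (lt_of_le_of_ne hle hS)
  have hφ : Unimodular r := ⟨(Lp.stronglyMeasurable r).measurable,
    norm_ae_eq_one_of_mem_orthogonal_shiftImage hz hr hrS hr1⟩
  have : CompleteSpace (unimodularImage ENNReal.ofNat_ne_top hφ (hardySubmodule 2 arc)) :=
    (isClosed_unimodularImage _ hφ (isClosed_hardySubmodule 2 arc)).completeSpace_coe
  refine ⟨r, hφ, (eq_of_le_of_forall_mem_orthogonal ?_ fun s hs hsr => ?_).symm⟩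
  · exact unimodularImage_hardySubmodule_le _ hK hz hφ (hasRep_coeFn_iff.2 hr)
  · exact eq_zero_of_mem_orthogonal_unimodularImage_hardySubmodule hz hφ hrS hs hsr

end SquareIntegrable

section InvariantSubspaces

variable {p : ℝ≥0∞} [Fact (1 ≤ p)]

theorem exists_eq_vanishingOff_or_exists_eq_unimodularImage (hp : p ≠ ∞)
    {M : Submodule ℂ (Lp ℂ p arc)} (hM : IsClosed (M : Set (Lp ℂ p arc)))
    (hz : ZInvariant (M : Set (Lp ℂ p arc))) :
    (∃ E : Set Circle, MeasurableSet E ∧ M = vanishingOff p arc E) ∨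
      ∃ (φ : Circle → ℂ) (hφ : Unimodular φ), M = unimodularImage hp hφ (hardySubmodule p arc) := by
  let K : Submodule ℂ (Lp ℂ 2 arc) := (interLp 2 M).topologicalClosure
  have hK : IsClosed (K : Set (Lp ℂ 2 arc)) := Submodule.isClosed_topologicalClosure _
  have hKz : ZInvariant (K : Set (Lp ℂ 2 arc)) :=
    (zInvariant_interLp ENNReal.ofNat_ne_top hz).topologicalClosure ENNReal.ofNat_ne_top
  have hMK (f : Circle → ℂ) (hf : MemLp f ∞ arc) : HasRep M f ↔ HasRep K f :=
    (hasRep_topologicalClosure_interLp_iff hp hM hz (hf.mono_exponent le_top)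
      (hf.mono_exponent le_top)).symm
  by_cases hS : shiftImage ENNReal.ofNat_ne_top K = K
  · obtain ⟨E, hE, hKE⟩ := exists_eq_vanishingOff_of_shiftImage_eq hK hS
    refine Or.inl ⟨E, hE, eq_of_forall_bounded hp hM hz isClosed_vanishingOff
      (zInvariant_vanishingOff hp E) fun f hf => ?_⟩
    rw [hMK f hf, hKE, hasRep_vanishingOff_iff (hf.mono_exponent le_top),
      hasRep_vanishingOff_iff (hf.mono_exponent le_top)]
  · obtain ⟨φ, hφ, hKφ⟩ := exists_eq_unimodularImage_of_shiftImage_ne hK hKz hS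
    refine Or.inr ⟨φ, hφ, eq_of_forall_bounded hp hM hz
      (isClosed_unimodularImage hp hφ (isClosed_hardySubmodule p arc))
      (zInvariant_unimodularImage hp hφ (zInvariant_hardySubmodule hp)) fun f hf => ?_⟩
    have hφf : MemLp (fun z => conj (φ z) * f z) ∞ arc := hφ.memLp_conj_mul hf
    rw [hMK f hf, hKφ, hasRep_unimodularImage_iff, hasRep_unimodularImage_iff]
    exact ⟨fun h => h.hardySubmodule_exponent hp (hφf.mono_exponent le_top),
      fun h => h.hardySubmodule_exponent ENNReal.ofNat_ne_top (hφf.mono_exponent le_top)⟩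

end InvariantSubspaces

section Density

variable {p : ℝ≥0∞} {ν : Measure Circle}

theorem measurable_densityRoot : Measurable (densityRoot p ν) :=
  Complex.measurable_ofReal.comp
    ((Measure.measurable_rnDeriv ν arc).ennreal_toReal.pow_const _)

variable [SigmaFinite ν] [Fact (1 ≤ p)]

theorem enorm_densityRoot_rpow (hp : p ≠ ∞) :
    ∀ᵐ z ∂arc, ‖densityRoot p ν z‖ₑ ^ p.toReal = ν.rnDeriv arc z := by
  have hpos : 0 < p.toReal := ENNReal.toReal_pos (zero_lt_one.trans_le Fact.out).ne' hp
  filter_upwards [Measure.rnDeriv_ne_top ν arc] with z hz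
  have h0 : 0 ≤ (ν.rnDeriv arc z).toReal ^ (1 / p.toReal) := by positivity
  rw [← ofReal_norm, densityRoot, Complex.norm_real, Real.norm_of_nonneg h0,
    ENNReal.ofReal_rpow_of_nonneg h0 hpos.le, ← Real.rpow_mul ENNReal.toReal_nonneg,
    one_div_mul_cancel hpos.ne', Real.rpow_one, ENNReal.ofReal_toReal hz]

theorem withDensity_enorm_densityRoot_rpow (hp : p ≠ ∞) (hν : ν ≪ arc) :
    arc.withDensity (fun z => ‖densityRoot p ν z‖ₑ ^ p.toReal) = ν := by
  rw [withDensity_congr_ae (enorm_densityRoot_rpow hp), Measure.withDensity_rnDeriv_eq ν arc hν]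

end Density

section Images

variable {p : ℝ≥0∞}

theorem mulImage_eq_setOf_hasRep [Fact (1 ≤ p)] {μ ν : Measure Circle} {w : Circle → ℂ} (hp : p ≠ ∞)
    (hw : Measurable w) (hμ : ν.withDensity (fun x => ‖w x‖ₑ ^ p.toReal) = μ)
    (W : Submodule ℂ (Lp ℂ p μ)) :
    mulImage ν w (W : Set (Lp ℂ p μ)) =
      {h : Circle →ₘ[ν] ℂ | HasRep (W.map (weightedMul hp hw hμ).toLinearMap) h} :=
  Set.ext fun _ => (hasRep_map_weightedMul_iff hp hw hμ).symm

theorem mulImage_indicator_univ {E : Set Circle} (hE : MeasurableSet E) :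
    mulImage arc (E.indicator fun _ => (1 : ℂ)) (Set.univ : Set (Lp ℂ p arc)) =
      {h : Circle →ₘ[arc] ℂ | HasRep (vanishingOff p arc E) h} := by
  ext h
  constructor
  · rintro ⟨f, -, hf⟩
    have hmul : ⇑h =ᵐ[arc] E.indicator f := by
      filter_upwards [hf] with z hz
      rw [hz, ← Set.indicator_mul_left]
      simp only [one_mul]
    have hmem : MemLp h p arc := (memLp_congr_ae hmul).2 ((Lp.memLp f).indicator hE)
    refine (hasRep_vanishingOff_iff hmem).2 ?_
    filter_upwards [hmul] with z hz hzE
    rw [hz, Set.indicator_of_notMem hzE]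
  · rintro ⟨f, hf, hfh⟩
    refine ⟨f, trivial, ?_⟩
    filter_upwards [hfh, hf] with z hfz hz
    by_cases hzE : z ∈ E
    · rw [← hfz, Set.indicator_of_mem hzE, one_mul]
    · rw [← hfz, hz hzE, mul_zero]

end Images

end HardyCircle

end

open HardyCircle in
theorem mainTheorem8_general (ν : Measure Circle) [SigmaFinite ν] (hν : ν ≪ arc)
    (p : ℝ≥0∞) [Fact (1 ≤ p)] (hp : p ≠ ∞)
    (W : Submodule ℂ (Lp ℂ p ν)) (hW : IsClosed (W : Set (Lp ℂ p ν)))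
    (hz : ZInvariant (W : Set (Lp ℂ p ν))) :
    (∃ E : Set Circle, MeasurableSet E ∧
      mulImage arc (densityRoot p ν) (W : Set (Lp ℂ p ν)) =
        mulImage arc (E.indicator fun _ => (1 : ℂ)) (Set.univ : Set (Lp ℂ p arc))) ∨
    (∃ φ : Circle → ℂ, Unimodular φ ∧
      mulImage arc (densityRoot p ν) (W : Set (Lp ℂ p ν)) =
        mulImage arc φ (hardy p arc)) := by
  have hw : Measurable (densityRoot p ν) := measurable_densityRoot
  have hwν := withDensity_enorm_densityRoot_rpow hp hν
  rw [mulImage_eq_setOf_hasRep hp hw hwν W]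
  rcases exists_eq_vanishingOff_or_exists_eq_unimodularImage hp
    (isClosed_map_weightedMul hp hw hwν hW) (hz.map_weightedMul hp hw hwν)
    with ⟨E, hE, h⟩ | ⟨φ, hφ, h⟩
  · exact Or.inl ⟨E, hE, by rw [h, mulImage_indicator_univ hE]⟩
  · refine Or.inr ⟨φ, hφ, ?_⟩
    rw [h, ← coe_hardySubmodule, mulImage_eq_setOf_hasRep hp hφ.1 hφ.withDensity_eq]
    rfl

/-- Closed `z`-invariant subspaces of `L^p(ν)`, for a probability measure `ν` on the circle that is
mutually absolutely continuous with normalized arc length. -/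
theorem mainTheorem8 (ν : Measure Circle) [IsProbabilityMeasure ν]
    (hν : ν ≪ HardyCircle.arc) (hν' : HardyCircle.arc ≪ ν)
    (p : ℝ≥0∞) [Fact (1 ≤ p)] (hp : p ≠ ∞)
    (W : Submodule ℂ (Lp ℂ p ν)) (hW : IsClosed (W : Set (Lp ℂ p ν)))
    (hz : HardyCircle.ZInvariant (W : Set (Lp ℂ p ν))) :
    (∃ E : Set Circle, MeasurableSet E ∧
      HardyCircle.mulImage HardyCircle.arc (HardyCircle.densityRoot p ν) (W : Set (Lp ℂ p ν)) =
        HardyCircle.mulImage HardyCircle.arc (E.indicator fun _ => (1 : ℂ))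
          (Set.univ : Set (Lp ℂ p HardyCircle.arc))) ∨
    (∃ φ : Circle → ℂ, HardyCircle.Unimodular φ ∧
      HardyCircle.mulImage HardyCircle.arc (HardyCircle.densityRoot p ν) (W : Set (Lp ℂ p ν)) =
        HardyCircle.mulImage HardyCircle.arc φ (HardyCircle.hardy p HardyCircle.arc)) :=
  mainTheorem8_general ν hν p hp W hW hz
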